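/- For real parameters $a,b$ let $F=F_{a,b}:\mathbb R^2\to\mathbb R^2$ be the map $F(x,y)=(ax-y,x)$ if $x>0$ or ($x=0$ and $y\le 0$), and $F(x,y)=(bx-y,x)$ otherwise. Give a point the symbol $a$ in the first case and $b$ in the second; the orbit of $z$ then has a symbolic word $W(z)$, whose prefix of length $n$ is denoted $W_n(z)$. For finite words $u,v$ let $|v|_u$ be the number of occurrences of $u$ as a factor of $v$. The rotation number and the density are $$\theta(a,b)=\lim_{n\to\infty}\frac1n|W_n(z)|_{ab}\quad\text{for any } z\neq(0,0),\qquad \rho(a,b)=\lim_{n\to\infty}\frac1{2n}\bigl(|W_n(0,1)|_a+|W_n(0,-1)|_a\bigr).$$ The boundary rays are $L^\pm=\{(0,\pm y):y>0\}$. A nonempty word $w$ of length $n$ is a boundary word at $(a,b)$ if there is a point $z\in L^+\cup L^-$ with $F^n(z)\in L^+\cup L^-$ such that, for $0\le t<n$, the letter $w_t$ is the symbol of $F^t(z)$, except that it may be arbitrary when $F^t(z)\in L^+\cup L^-$. The rank of $w$ is $1+|w|_{ab}+|w|_{ba}$. If the rank is odd, the set of all $(a,b)\in\mathbb R^2$ at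 which $w$ is a boundary word is called the critical curve of $w$, of that rank. Let $\zeta_\kappa=2\cos(\pi/\kappa)$. **Proposition.** Let $\kappa\ge2$ be an integer. The line $\{(\zeta_\kappa,b):b\in\mathbb R\}$ is the critical curve of the word $a^\kappa$, and it has rank 1. For every real $b$ the limits defining $\theta(\zeta_\kappa,b)$ and $\rho(\zeta_\kappa,b)$ exist, the former being the same for all initial points $z\ne(0,0)$, and $$\rho(\zeta_\kappa,b)=\kappa\,\theta(\zeta_\kappa,b),\qquad \theta(\zeta_\kappa,b)=\begin{cases}0 & b>2,\\[2pt] \dfrac{\arccos(b/2)}{\kappa\arccos(b/2)+\pi} & |b|\le 2,\\[6pt] \dfrac1{\kappa+1} & b<-2.\end{cases}$$ Symmetrically, the line $\{(a,\zeta_\kappa):a\in\mathbb R\}$ is the critical curve of the word $b^\kappa$, of rank 1, and for every real $a$ the corresponding limits exist and satisfy $\theta(a,\zeta_\kappa)=\theta(\zeta_\kappa,a)$ and $\rho(a,\zeta_\kappa)=1-\rho(\zeta_\kappa,a)$. -/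

import Mathlib

open Filter Topology

noncomputable section

namespace PLMap

/-- The two symbols; `a` stands for the right half-plane, `b` for the left one. -/
inductive Letter
  | a
  | b
  deriving DecidableEq

/-- The half-plane symbol of a point: `a` if `x > 0`, or if `x = 0` and `y ≤ 0`; `b` otherwise. -/
def symbol (z : ℝ × ℝ) : Letter :=
  if 0 < z.1 ∨ (z.1 = 0 ∧ z.2 ≤ 0) then Letter.a else Letter.b

/-- The piecewise linear planar map `F` with real parameters `a`, `b`. -/
def F (a b : ℝ) (z : ℝ × ℝ) : ℝ × ℝ :=
  if 0 < z.1 ∨ (z.1 = 0 ∧ z.2 ≤ 0) then (a * z.1 - z.2, z.1) else (b * z.1 - z.2, z.1)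

/-- The prefix of length `n` of the symbolic word of the forward `F`-orbit of `z`. -/
def orbitWord (a b : ℝ) (z : ℝ × ℝ) (n : ℕ) : List Letter :=
  (List.range n).map fun t => symbol ((F a b)^[t] z)

/-- `occ u v` is the number `|v|_u` of occurrences of the (nonempty) word `u`
as a factor of the finite word `v`. -/
def occ (u v : List Letter) : ℕ :=
  ((Finset.range v.length).filter fun i => u <+: v.drop i).card

/-- `θ` is the rotation number at the parameters `(a, b)`: for every orbit (other than the fixed
point at the origin, which carries no ray), the frequency of the factor `ab` in its word
exists and equals `θ`. -/
def IsRotationNumber (a b θ : ℝ) : Prop :=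
  ∀ z : ℝ × ℝ, z ≠ 0 →
    Tendsto (fun n : ℕ => (1 / (n : ℝ)) * (occ [Letter.a, Letter.b] (orbitWord a b z n) : ℝ))
      atTop (𝓝 θ)

/-- `ρ` is the density at the parameters `(a, b)`: the average of the frequencies of the
symbol `a` along the two orbits that start at `(0, 1)` and `(0, -1)`. -/
def IsDensity (a b ρ : ℝ) : Prop :=
  Tendsto (fun n : ℕ => (1 / (2 * (n : ℝ))) *
      ((occ [Letter.a] (orbitWord a b (0, 1) n) : ℝ)
        + (occ [Letter.a] (orbitWord a b (0, -1) n) : ℝ)))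
    atTop (𝓝 ρ)

/-- The positive ordinate semi-axis, as a ray (so without the origin). -/
def Lplus : Set (ℝ × ℝ) := {z | z.1 = 0 ∧ 0 < z.2}

/-- The negative ordinate semi-axis, as a ray (so without the origin). -/
def Lminus : Set (ℝ × ℝ) := {z | z.1 = 0 ∧ z.2 < 0}

/-- `w` is a boundary word at the parameters `(a, b)`: it encodes the itinerary of a segment of
an `F`-orbit that leads from a boundary ray to a boundary ray, where the letters allocated to
points on boundary rays may be chosen freely. -/
def IsBoundaryWord (a b : ℝ) (w : List Letter) : Prop :=
  w ≠ [] ∧ ∃ z ∈ Lplus ∪ Lminus, (F a b)^[w.length] z ∈ Lplus ∪ Lminus ∧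
    ∀ (t : ℕ) (ht : t < w.length),
      w[t] = symbol ((F a b)^[t] z) ∨ (F a b)^[t] z ∈ Lplus ∪ Lminus

/-- The rank `1 + |w|_{ab} + |w|_{ba}` of a word. -/
def rank (w : List Letter) : ℕ :=
  1 + occ [Letter.a, Letter.b] w + occ [Letter.b, Letter.a] w

/-- `C` is the critical curve of rank `ι` with boundary word `w`: the rank is odd, and `C`
is the set of all parameters for which `w` is a boundary word. -/
def IsCriticalCurve (w : List Letter) (ι : ℕ) (C : Set (ℝ × ℝ)) : Prop :=
  rank w = ι ∧ Odd ι ∧ C = {p | IsBoundaryWord p.1 p.2 w}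

/-- `ζ_j = 2 cos (π / j)`. -/
def zeta (j : ℕ) : ℝ := 2 * Real.cos (Real.pi / j)

end PLMap

end

namespace PLMap

/-! ### Elementary facts about the map -/

/-! On a run of letters `a` with `a = 2 cos φ`, the map is linear and conjugate to the rotation by
`φ`. For `φ = π / κ` its `κ`-th power is `-1`, so an orbit that enters the right half-plane at `z`
stays there for exactly `κ` steps and leaves at `-z`. This makes `a^κ` a boundary word on the line;
the converse follows by locating the zeros of `sin (t * φ)`.

Replacing each complete excursion by the reflection `z ↦ -z` leaves the projective action of the
linear map `linStep c` on the left half-plane. It crosses with frequency `ν = arccos (c / 2) / π`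
per letter `b`, and an `IsPotential` witnesses this with bounded error. Each crossing costs `κ`
letters `a`. With `T` crossings and `A` letters `a` in `n` steps, `A ≈ κ T` and `T ≈ ν (n - A)`,
hence `T / n → ν / (1 + κ ν) = θ` and `A / n → κ θ`.

Both relations hold as exact coboundary identities (`exitTime_zeta_F_sub`,
`IsPotential.exitPoint_zeta_F_sub`), so the errors telescope to a bounded quantity for every orbit
outside the origin. The conjugacy `z ↦ -z` exchanges the two parameters and yields the second line.
-/

/-- The exchange of the two symbols. -/
def Letter.flip : Letter → Letter
  | .a => .b
  | .b => .a

theorem symbol_eq_a_iff {z : ℝ × ℝ} :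
    symbol z = .a ↔ 0 < z.1 ∨ (z.1 = 0 ∧ z.2 ≤ 0) := by
  unfold symbol; split_ifs with h <;> simp [h]

theorem symbol_eq_b_iff {z : ℝ × ℝ} :
    symbol z = .b ↔ z.1 < 0 ∨ (z.1 = 0 ∧ 0 < z.2) := by
  unfold symbol
  split_ifs with h
  · simp only [false_iff]
    rintro (h1 | ⟨h1, h1'⟩) <;> rcases h with h | ⟨h, h'⟩ <;> linarith
  · simp only [true_iff]
    rcases lt_trichotomy z.1 0 with h1 | h1 | h1
    · exact .inl h1
    · exact .inr ⟨h1, by by_contra h2; exact h (.inr ⟨h1, not_lt.mp h2⟩)⟩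
    · exact (h (.inl h1)).elim

theorem symbol_ne_a_iff {z : ℝ × ℝ} : symbol z ≠ .a ↔ symbol z = .b := by
  cases symbol z <;> simp

theorem ne_zero_of_symbol_eq_b {z : ℝ × ℝ} (h : symbol z = .b) : z ≠ 0 := by
  rintro rfl
  simp [symbol_eq_b_iff] at h

theorem F_of_symbol_a {a b : ℝ} {z : ℝ × ℝ} (h : symbol z = .a) :
    F a b z = (a * z.1 - z.2, z.1) := by
  rw [F, if_pos (symbol_eq_a_iff.mp h)]

theorem F_of_symbol_b {a b : ℝ} {z : ℝ × ℝ} (h : symbol z = .b) :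
    F a b z = (b * z.1 - z.2, z.1) := by
  rw [F, if_neg fun h' => by simp [symbol_eq_a_iff.mpr h'] at h]

theorem F_ne_zero {a b : ℝ} {z : ℝ × ℝ} (hz : z ≠ 0) : F a b z ≠ 0 := by
  intro h
  apply hz
  rcases hs : symbol z
  · rw [F_of_symbol_a hs, Prod.ext_iff] at h
    simp only [Prod.fst_zero, Prod.snd_zero] at h
    obtain ⟨h1, h2⟩ := h
    rw [h2] at h1
    exact Prod.ext h2 (by simpa using h1)
  · rw [F_of_symbol_b hs, Prod.ext_iff] at h
    simp only [Prod.fst_zero, Prod.snd_zero] at h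
    obtain ⟨h1, h2⟩ := h
    rw [h2] at h1
    exact Prod.ext h2 (by simpa using h1)

theorem iterate_F_ne_zero {a b : ℝ} {z : ℝ × ℝ} (hz : z ≠ 0) (n : ℕ) : (F a b)^[n] z ≠ 0 := by
  induction n with
  | zero => simpa
  | succ n ih => rw [Function.iterate_succ_apply']; exact F_ne_zero ih

theorem symbol_neg {z : ℝ × ℝ} (hz : z ≠ 0) : symbol (-z) = (symbol z).flip := by
  rcases hs : symbol z
  · rw [symbol_eq_a_iff] at hs
    rw [Letter.flip, symbol_eq_b_iff]
    rcases hs with h | ⟨h, h'⟩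
    · left; simpa
    · right
      refine ⟨by simpa, ?_⟩
      have : z.2 ≠ 0 := fun h2 => hz (Prod.ext h h2)
      simpa using lt_of_le_of_ne h' this
  · rw [symbol_eq_b_iff] at hs
    rw [Letter.flip, symbol_eq_a_iff]
    rcases hs with h | ⟨h, h'⟩
    · left; simpa
    · right; exact ⟨by simpa, by simpa using h'.le⟩

theorem F_neg {a b : ℝ} {z : ℝ × ℝ} (hz : z ≠ 0) : F b a (-z) = -F a b z := by
  have h := symbol_neg hz
  rcases hs : symbol z <;> rw [hs, Letter.flip] at h
  · rw [F_of_symbol_a hs, F_of_symbol_b h]; ext <;> simp; ring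
  · rw [F_of_symbol_b hs, F_of_symbol_a h]; ext <;> simp; ring

theorem iterate_F_neg {a b : ℝ} {z : ℝ × ℝ} (hz : z ≠ 0) (n : ℕ) :
    (F b a)^[n] (-z) = -(F a b)^[n] z := by
  induction n with
  | zero => simp
  | succ n ih =>
    rw [Function.iterate_succ_apply', Function.iterate_succ_apply', ih,
      F_neg (iterate_F_ne_zero hz n)]

/-- Both sides satisfy the recurrence of `sin (t * φ)` with coefficient `2 cos φ`. The factor `sin
φ` avoids division, and `n - 1` is a real subtraction, so `n = 0` is included. -/
theorem sin_mul_iterate_F {φ b : ℝ} {z : ℝ × ℝ} {n : ℕ}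
    (h : ∀ j < n, symbol ((F (2 * Real.cos φ) b)^[j] z) = .a) :
    Real.sin φ * ((F (2 * Real.cos φ) b)^[n] z).1
        = z.1 * Real.sin ((n + 1) * φ) - z.2 * Real.sin (n * φ) ∧
      Real.sin φ * ((F (2 * Real.cos φ) b)^[n] z).2
        = z.1 * Real.sin (n * φ) - z.2 * Real.sin ((n - 1) * φ) := by
  induction n with
  | zero => simp; constructor <;> ring
  | succ n ih =>
    obtain ⟨h1, h2⟩ := ih fun j hj => h j (hj.trans n.lt_succ_self)
    rw [Function.iterate_succ_apply', F_of_symbol_a (h n n.lt_succ_self)]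
    have key (t : ℝ) : Real.sin ((t + 1) * φ)
        = 2 * Real.cos φ * Real.sin (t * φ) - Real.sin ((t - 1) * φ) := by
      rw [add_mul, sub_mul, one_mul, Real.sin_add, Real.sin_sub]; ring
    have k1 := key (n + 1)
    have k2 := key n
    push_cast
    rw [add_sub_cancel_right] at k1 ⊢
    constructor
    · linear_combination (2 * Real.cos φ) * h1 - h2 - z.1 * k1 + z.2 * k2
    · exact h1

theorem pi_div_pos_and_sin_pos {κ : ℕ} (hκ : 2 ≤ κ) :
    0 < Real.pi / κ ∧ 0 < Real.sin (Real.pi / κ) := by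
  have hκ' : (2 : ℝ) ≤ κ := by exact_mod_cast hκ
  have h : 0 < Real.pi / κ := by positivity
  refine ⟨h, Real.sin_pos_of_pos_of_lt_pi h ?_⟩
  rw [div_lt_iff₀ (by linarith)]
  nlinarith [Real.pi_pos]

theorem iterate_zeta_eq_neg {κ : ℕ} (hκ : 2 ≤ κ) {b : ℝ} {z : ℝ × ℝ}
    (h : ∀ j < κ, symbol ((F (zeta κ) b)^[j] z) = .a) : (F (zeta κ) b)^[κ] z = -z := by
  obtain ⟨-, hsin⟩ := pi_div_pos_and_sin_pos hκ
  have hκφ : κ * (Real.pi / κ) = Real.pi := by field_simp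
  obtain ⟨h1, h2⟩ := sin_mul_iterate_F h
  rw [add_mul, hκφ, one_mul, Real.sin_pi, add_comm, Real.sin_add_pi] at h1
  rw [sub_mul, hκφ, one_mul, Real.sin_pi, Real.sin_pi_sub] at h2
  refine Prod.ext (mul_left_cancel₀ hsin.ne' (h1.trans ?_)) (mul_left_cancel₀ hsin.ne' (h2.trans ?_))
  · simp; ring
  · simp; ring

/-- A point of the fourth quadrant has symbol `a` for `κ` steps. -/
theorem symbol_iterate_zeta_of_entering {κ : ℕ} (hκ : 2 ≤ κ) (b : ℝ) {z : ℝ × ℝ}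
    (hx : 0 ≤ z.1) (hy : z.2 < 0) : ∀ j < κ, symbol ((F (zeta κ) b)^[j] z) = .a := by
  obtain ⟨hφ0, hsin⟩ := pi_div_pos_and_sin_pos hκ
  have hκφ : κ * (Real.pi / κ) = Real.pi := by field_simp
  intro j
  induction j using Nat.strong_induction_on with
  | _ j ih =>
    intro hj
    have h := (sin_mul_iterate_F fun i hi => ih i hi (hi.trans hj)).1
    rw [symbol_eq_a_iff]
    rcases Nat.eq_zero_or_pos j with rfl | hj0
    · simpa [hy.le] using hx.lt_or_eq.imp_right Eq.symm
    · left
      have hj0' : (0 : ℝ) < j := by exact_mod_cast hj0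
      have hj1 : (j : ℝ) + 1 ≤ κ := by exact_mod_cast hj
      have h1 : 0 < Real.sin (j * (Real.pi / κ)) :=
        Real.sin_pos_of_pos_of_lt_pi (by positivity) (by nlinarith)
      have h2 : 0 ≤ Real.sin ((j + 1) * (Real.pi / κ)) :=
        Real.sin_nonneg_of_nonneg_of_le_pi (by positivity) (by nlinarith)
      refine pos_of_mul_pos_right (lt_of_lt_of_eq ?_ h.symm) hsin.le
      nlinarith [mul_nonneg hx h2, mul_pos (neg_pos.mpr hy) h1]

/-! ### Boundary words -/

theorem mem_rays_iff {z : ℝ × ℝ} : z ∈ Lplus ∪ Lminus ↔ z.1 = 0 ∧ z.2 ≠ 0 := by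
  simp only [Lplus, Lminus, Set.mem_union, Set.mem_ofPred_eq, ne_iff_lt_or_gt]
  tauto

theorem ne_zero_of_mem_rays {z : ℝ × ℝ} (hz : z ∈ Lplus ∪ Lminus) : z ≠ 0 := by
  rintro rfl
  exact (mem_rays_iff.mp hz).2 rfl

theorem neg_mem_rays_iff {z : ℝ × ℝ} : -z ∈ Lplus ∪ Lminus ↔ z ∈ Lplus ∪ Lminus := by
  rw [mem_rays_iff, mem_rays_iff]
  simp

theorem IsBoundaryWord.flip {a b : ℝ} {w : List Letter} (h : IsBoundaryWord a b w) :
    IsBoundaryWord b a (w.map Letter.flip) := by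
  obtain ⟨hw, z, hz, hz', ht⟩ := h
  have hz0 := ne_zero_of_mem_rays hz
  refine ⟨by simpa, -z, neg_mem_rays_iff.mpr hz, ?_, fun t h => ?_⟩
  · rw [List.length_map, iterate_F_neg hz0]; exact neg_mem_rays_iff.mpr hz'
  · rw [List.length_map] at h
    rw [iterate_F_neg hz0, neg_mem_rays_iff, symbol_neg (iterate_F_ne_zero hz0 t), List.getElem_map]
    exact (ht t h).imp_left (congrArg Letter.flip)

theorem isBoundaryWord_replicate_a_zeta {κ : ℕ} (hκ : 2 ≤ κ) (b : ℝ) :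
    IsBoundaryWord (zeta κ) b (List.replicate κ .a) := by
  have hsym := symbol_iterate_zeta_of_entering hκ b (z := (0, -1)) le_rfl (by norm_num)
  refine ⟨by simp; omega, (0, -1), mem_rays_iff.mpr (by norm_num), ?_, fun t ht => .inl ?_⟩
  · rw [List.length_replicate, iterate_zeta_eq_neg hκ hsym, neg_mem_rays_iff, mem_rays_iff]
    norm_num
  · rw [List.length_replicate] at ht
    rw [List.getElem_replicate, hsym t ht]

/-- A segment of letters `a` starting on a ray follows a multiple of `sin (t * φ)`; its return to a
ray at time `κ`, with no earlier sign change, forces `κ * φ = π`. -/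
theorem eq_zeta_of_isBoundaryWord_replicate_a {κ : ℕ} (hκ : 2 ≤ κ) {a b : ℝ}
    (h : IsBoundaryWord a b (List.replicate κ .a)) : a = zeta κ := by
  obtain ⟨-, z, hz, hzκ, ht⟩ := h
  simp only [List.length_replicate, List.getElem_replicate] at hzκ ht
  have hz0 := ne_zero_of_mem_rays hz
  have hz1 := (mem_rays_iff.mp hz).1
  have hmem : ∀ t ≤ κ, symbol ((F a b)^[t] z) = .b → (F a b)^[t] z ∈ Lplus ∪ Lminus := by
    intro t htκ hb
    rcases htκ.lt_or_eq with h | rfl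
    · exact (ht t h).resolve_left (by simp [hb])
    · exact hzκ
  -- The freedom of letters on rays gains nothing: a ray point with symbol `b` lies on `Lplus`, and
  -- its image lies on the negative abscissa, where the symbol is `b` and not free.
  have hsym : ∀ t < κ, symbol ((F a b)^[t] z) = .a := by
    intro t htκ
    by_contra hne
    have hb := symbol_ne_a_iff.mp hne
    have hm := mem_rays_iff.mp (hmem t htκ.le hb)
    have hpos : 0 < ((F a b)^[t] z).2 := by
      rcases symbol_eq_b_iff.mp hb with h | h
      · exact (h.ne hm.1).elim
      · exact h.2
    have hs : (F a b)^[t + 1] z = (-((F a b)^[t] z).2, 0) := by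
      rw [Function.iterate_succ_apply', F_of_symbol_b hb, hm.1]; simp
    have := mem_rays_iff.mp (hmem (t + 1) htκ (by rw [hs, symbol_eq_b_iff]; left; simpa))
    rw [hs] at this
    exact this.2 rfl
  have hy : z.2 < 0 := by
    have := hsym 0 (by omega)
    rw [Function.iterate_zero_apply, symbol_eq_a_iff, hz1] at this
    exact lt_of_le_of_ne (by simpa using this) (mem_rays_iff.mp hz).2
  have hx1 : (F a b)^[1] z = (-z.2, 0) := by
    rw [Function.iterate_one, F_of_symbol_a (z := z) (hsym 0 (by omega)), hz1]; simp
  have hκ0 := (mem_rays_iff.mp hzκ).1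
  have ha0 : 0 ≤ a := by
    have hx2 : ((F a b)^[2] z).1 = a * -z.2 := by
      rw [Function.iterate_succ_apply', hx1, F_of_symbol_a]
      · simp
      · rw [symbol_eq_a_iff]; left; simpa
    have : 0 ≤ ((F a b)^[2] z).1 := by
      rcases hκ.lt_or_eq with h | h
      · rcases symbol_eq_a_iff.mp (hsym 2 h) with h | h
        · exact h.le
        · exact h.1.ge
      · exact (h ▸ hκ0).ge
    rw [hx2] at this
    exact nonneg_of_mul_nonneg_left this (by linarith)
  -- For `a ≥ 2` the cone `0 ≤ y < x` is invariant, so the orbit never returns to a ray.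
  have ha2 : a < 2 := by
    by_contra! ha
    have hgrow : ∀ t, t + 1 ≤ κ → 0 ≤ ((F a b)^[t + 1] z).2 ∧
        ((F a b)^[t + 1] z).2 < ((F a b)^[t + 1] z).1 := by
      intro t
      induction t with
      | zero => intro _; rw [hx1]; simpa
      | succ t ih =>
        intro htκ
        obtain ⟨h1, h2⟩ := ih (by omega)
        rw [Function.iterate_succ_apply', F_of_symbol_a (hsym (t + 1) htκ)]
        exact ⟨h1.trans h2.le, by simp only; nlinarith⟩
    obtain ⟨n, rfl⟩ : ∃ n, κ = n + 1 := ⟨κ - 1, by omega⟩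
    have := hgrow n le_rfl
    linarith
  set φ := Real.arccos (a / 2) with hφ
  have hcos : a = 2 * Real.cos φ := by
    rw [hφ, Real.cos_arccos (by linarith) (by linarith)]; ring
  have hφ0 : 0 < φ := Real.arccos_pos.mpr (by linarith)
  have hφπ : φ < Real.pi := by
    have : φ ≤ Real.pi / 2 := Real.arccos_le_pi_div_two.mpr (by linarith)
    linarith [Real.pi_pos]
  have hsin : 0 < Real.sin φ := Real.sin_pos_of_pos_of_lt_pi hφ0 hφπ
  have hformula : ∀ t ≤ κ, Real.sin φ * ((F a b)^[t] z).1 = -z.2 * Real.sin (t * φ) := by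
    intro t htκ
    have := (sin_mul_iterate_F (φ := φ) (b := b) (z := z) (n := t)
      fun j hj => hcos ▸ hsym j (hj.trans_le htκ)).1
    rw [← hcos, hz1] at this
    linarith
  -- At the first time with `t * φ ≥ π` the abscissa would be nonpositive, so symbol `a` forces it
  -- to be zero with nonpositive ordinate; but the ordinate is the previous abscissa, which is
  -- positive.
  have hlt : ∀ t < κ, t * φ < Real.pi := by
    intro t
    induction t with
    | zero => intro _; simpa using Real.pi_pos
    | succ t ih =>
      intro htκ
      by_contra! hge
      have h1 := ih (by omega)
      push_cast at hge
      have hf := hformula (t + 1) htκ.le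
      have hneg : Real.sin ((t + 1 : ℝ) * φ) ≤ 0 := by
        have : 0 ≤ Real.sin ((t + 1 : ℝ) * φ - Real.pi) :=
          Real.sin_nonneg_of_nonneg_of_le_pi (by linarith) (by nlinarith)
        rw [Real.sin_sub_pi] at this
        linarith
      push_cast at hf
      have hx0 : 0 ≤ ((F a b)^[t + 1] z).1 := by
        rcases symbol_eq_a_iff.mp (hsym (t + 1) htκ) with h | h
        · exact h.le
        · exact h.1.ge
      have hxz : ((F a b)^[t + 1] z).1 = 0 := by
        have := mul_nonneg hsin.le hx0
        have : Real.sin φ * ((F a b)^[t + 1] z).1 = 0 := le_antisymm (by nlinarith) this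
        exact (mul_eq_zero.mp this).resolve_left hsin.ne'
      have hy2 := (symbol_eq_a_iff.mp (hsym (t + 1) htκ)).resolve_left (by rw [hxz]; simp)
      have hy3 : ((F a b)^[t + 1] z).2 = ((F a b)^[t] z).1 := by
        rw [Function.iterate_succ_apply', F_of_symbol_a (hsym t (by omega))]
      rcases Nat.eq_zero_or_pos t with rfl | ht0
      · norm_num at hge; linarith
      · have hp : 0 < Real.sin (t * φ) :=
          Real.sin_pos_of_pos_of_lt_pi (mul_pos (by exact_mod_cast ht0) hφ0) h1
        have := hformula t (by omega)
        rw [← hy3] at this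
        nlinarith [mul_pos (neg_pos.mpr hy) hp, hy2.2]
  have hκφ : κ * φ = Real.pi := by
    have hs : Real.sin (κ * φ) = 0 := by
      have := hformula κ le_rfl
      rw [hκ0, mul_zero] at this
      exact (mul_eq_zero.mp this.symm).resolve_left (by linarith)
    -- This gives `κ * φ < π + φ < 2 * π`, so `π` is the only possible zero of the sine.
    have h1 := hlt (κ - 1) (by omega)
    rw [Nat.cast_sub (by omega), Nat.cast_one] at h1
    have hκ' : (2 : ℝ) ≤ κ := by exact_mod_cast hκ
    rcases lt_trichotomy (κ * φ) Real.pi with h | h | h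
    · exact absurd hs (Real.sin_pos_of_pos_of_lt_pi (by nlinarith) h).ne'
    · exact h
    · have := Real.sin_pos_of_pos_of_lt_pi (x := κ * φ - Real.pi) (by linarith) (by nlinarith)
      rw [Real.sin_sub_pi, hs] at this
      simp at this
  rw [hcos, zeta, ← hκφ]
  field_simp

theorem isBoundaryWord_replicate_a_iff {κ : ℕ} (hκ : 2 ≤ κ) {a b : ℝ} :
    IsBoundaryWord a b (List.replicate κ .a) ↔ a = zeta κ :=
  ⟨eq_zeta_of_isBoundaryWord_replicate_a hκ, fun h => h ▸ isBoundaryWord_replicate_a_zeta hκ b⟩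

theorem isBoundaryWord_replicate_b_iff {κ : ℕ} (hκ : 2 ≤ κ) {a b : ℝ} :
    IsBoundaryWord a b (List.replicate κ .b) ↔ b = zeta κ := by
  rw [← isBoundaryWord_replicate_a_iff hκ (b := a)]
  exact ⟨fun h => by simpa [Letter.flip] using h.flip, fun h => by simpa [Letter.flip] using h.flip⟩

theorem occ_replicate_eq_zero {u : List Letter} {x y : Letter} (n : ℕ) (hy : y ∈ u)
    (hxy : y ≠ x) : occ u (List.replicate n x) = 0 := by
  rw [occ, Finset.card_eq_zero, Finset.filter_eq_empty_iff]
  intro i _ h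
  exact hxy (List.eq_of_mem_replicate (List.mem_of_mem_drop (h.subset hy)))

theorem rank_replicate (n : ℕ) (x : Letter) : rank (List.replicate n x) = 1 := by
  cases x <;>
    simp [rank, occ_replicate_eq_zero n (y := .a), occ_replicate_eq_zero n (y := .b)]

theorem isCriticalCurve_replicate_a {κ : ℕ} (hκ : 2 ≤ κ) :
    IsCriticalCurve (List.replicate κ .a) 1 {p : ℝ × ℝ | ∃ b : ℝ, p = (zeta κ, b)} := by
  refine ⟨rank_replicate _ _, odd_one, ?_⟩
  ext ⟨a, b⟩
  simp [isBoundaryWord_replicate_a_iff hκ]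

theorem isCriticalCurve_replicate_b {κ : ℕ} (hκ : 2 ≤ κ) :
    IsCriticalCurve (List.replicate κ .b) 1 {p : ℝ × ℝ | ∃ a : ℝ, p = (a, zeta κ)} := by
  refine ⟨rank_replicate _ _, odd_one, ?_⟩
  ext ⟨a, b⟩
  simp [isBoundaryWord_replicate_b_iff hκ]

/-! ### Excursions to the right half-plane -/

/-- The time that the orbit of `z` needs to reach the left half-plane. -/
noncomputable def exitTime (a b : ℝ) (z : ℝ × ℝ) : ℕ :=
  sInf {j | symbol ((F a b)^[j] z) = .b}

/-- The first point of the orbit of `z` in the left half-plane. -/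
noncomputable def exitPoint (a b : ℝ) (z : ℝ × ℝ) : ℝ × ℝ :=
  (F a b)^[exitTime a b z] z

theorem exitTime_of_symbol_b {a b : ℝ} {z : ℝ × ℝ} (h : symbol z = .b) : exitTime a b z = 0 :=
  Nat.sInf_eq_zero.mpr (.inl h)

theorem exitPoint_of_symbol_b {a b : ℝ} {z : ℝ × ℝ} (h : symbol z = .b) : exitPoint a b z = z := by
  rw [exitPoint, exitTime_of_symbol_b h, Function.iterate_zero_apply]

/-- If the first `κ` letters are `a`, the orbit is at `-z`, whose symbol is opposite. Hence the
infimum in `exitTime` is over a nonempty set. -/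
theorem exists_symbol_iterate_zeta_eq_b {κ : ℕ} (hκ : 2 ≤ κ) (b : ℝ) {z : ℝ × ℝ} (hz : z ≠ 0) :
    ∃ j ≤ κ, symbol ((F (zeta κ) b)^[j] z) = .b := by
  by_contra! h
  have h' : ∀ j ≤ κ, symbol ((F (zeta κ) b)^[j] z) = .a := fun j hj => by
    by_contra hne; exact h j hj (symbol_ne_a_iff.mp hne)
  have h0 := h' 0 (Nat.zero_le _)
  have h1 := h' κ le_rfl
  rw [iterate_zeta_eq_neg hκ fun j hj => h' j hj.le, symbol_neg hz] at h1
  rw [Function.iterate_zero_apply] at h0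
  simp [Letter.flip, h0] at h1

theorem exitTime_zeta_le {κ : ℕ} (hκ : 2 ≤ κ) (b : ℝ) {z : ℝ × ℝ} (hz : z ≠ 0) :
    exitTime (zeta κ) b z ≤ κ := by
  obtain ⟨j, hj, hs⟩ := exists_symbol_iterate_zeta_eq_b hκ b hz
  exact (Nat.sInf_le hs).trans hj

theorem symbol_iterate_exitTime_zeta {κ : ℕ} (hκ : 2 ≤ κ) (b : ℝ) {z : ℝ × ℝ} (hz : z ≠ 0) :
    symbol ((F (zeta κ) b)^[exitTime (zeta κ) b z] z) = .b := by
  obtain ⟨j, -, hs⟩ := exists_symbol_iterate_zeta_eq_b hκ b hz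
  exact Nat.sInf_mem (s := {j | symbol ((F (zeta κ) b)^[j] z) = .b}) ⟨j, hs⟩

theorem exitTime_zeta_of_symbol_a {κ : ℕ} (hκ : 2 ≤ κ) (b : ℝ) {z : ℝ × ℝ} (hz : z ≠ 0)
    (h : symbol z = .a) :
    exitTime (zeta κ) b z = exitTime (zeta κ) b (F (zeta κ) b z) + 1 := by
  apply le_antisymm
  · exact Nat.sInf_le (symbol_iterate_exitTime_zeta hκ b (F_ne_zero hz))
  · have hs := symbol_iterate_exitTime_zeta hκ b hz
    rcases ht : exitTime (zeta κ) b z with _ | m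
    · rw [ht, Function.iterate_zero_apply, h] at hs
      cases hs
    · rw [ht, Function.iterate_succ_apply] at hs
      exact Nat.succ_le_succ (Nat.sInf_le hs)

theorem exitPoint_zeta_of_symbol_a {κ : ℕ} (hκ : 2 ≤ κ) (b : ℝ) {z : ℝ × ℝ} (hz : z ≠ 0)
    (h : symbol z = .a) :
    exitPoint (zeta κ) b (F (zeta κ) b z) = exitPoint (zeta κ) b z := by
  rw [exitPoint, exitPoint, exitTime_zeta_of_symbol_a hκ b hz h, Function.iterate_succ_apply]

theorem exitTime_zeta_of_entering {κ : ℕ} (hκ : 2 ≤ κ) (b : ℝ) {z : ℝ × ℝ}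
    (hx : 0 ≤ z.1) (hy : z.2 < 0) : exitTime (zeta κ) b z = κ := by
  have hz : z ≠ 0 := by rintro rfl; simp at hy
  refine le_antisymm (exitTime_zeta_le hκ b hz) (not_lt.mp fun hlt => ?_)
  have h := symbol_iterate_exitTime_zeta hκ b hz
  rw [symbol_iterate_zeta_of_entering hκ b hx hy _ hlt] at h
  cases h

theorem exitPoint_zeta_of_entering {κ : ℕ} (hκ : 2 ≤ κ) (b : ℝ) {z : ℝ × ℝ}
    (hx : 0 ≤ z.1) (hy : z.2 < 0) : exitPoint (zeta κ) b z = -z := by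
  rw [exitPoint, exitTime_zeta_of_entering hκ b hx hy]
  exact iterate_zeta_eq_neg hκ (symbol_iterate_zeta_of_entering hκ b hx hy)

/-- The linear map that coincides with `F` on the left half-plane. -/
def linStep (c : ℝ) (z : ℝ × ℝ) : ℝ × ℝ := (c * z.1 - z.2, z.1)

/-- The new ordinate is the old abscissa. Points of `Lplus` do not cross, as they land on the
negative abscissa, so the ordinate is strictly negative. -/
theorem entering_of_symbol_linStep {c : ℝ} {z : ℝ × ℝ} (h : symbol z = .b)
    (h' : symbol (linStep c z) = .a) : 0 ≤ (linStep c z).1 ∧ (linStep c z).2 < 0 := by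
  rw [symbol_eq_b_iff] at h
  rw [symbol_eq_a_iff] at h'
  simp only [linStep] at h' ⊢
  rcases h with h | ⟨h1, h2⟩
  · exact ⟨h'.elim le_of_lt fun h => h.1.ge, h⟩
  · rw [h1] at h'
    rcases h' with h' | h' <;> linarith [h']

/-! ### Potentials for the projective action of a linear map -/

/-- A bounded function on the left half-plane which a step of the linear map, followed by a
reflection in the origin where necessary, increases by `ν`, or by `ν - 1` in case of a reflection. -/
structure IsPotential (c ν : ℝ) (β : ℝ × ℝ → ℝ) : Prop where
  abs_le : ∀ z, |β z| ≤ 1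
  stay : ∀ z, symbol z = .b → symbol (linStep c z) = .b → β (linStep c z) = β z + ν
  cross : ∀ z, symbol z = .b → symbol (linStep c z) = .a → β (-linStep c z) = β z + ν - 1

theorem exists_isPotential_of_abs_lt_two {c : ℝ} (hc : |c| < 2) :
    ∃ β, IsPotential c (Real.arccos (c / 2) / Real.pi) β := by
  rw [abs_lt] at hc
  set φ := Real.arccos (c / 2) with hφ
  have hφ0 : 0 < φ := Real.arccos_pos.mpr (by linarith)
  have hφπ : φ < Real.pi := Real.arccos_lt_pi.mpr (by linarith)
  have hcos : c = 2 * Real.cos φ := by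
    rw [hφ, Real.cos_arccos (by linarith) (by linarith)]; ring
  have hsin : 0 < Real.sin φ := Real.sin_pos_of_pos_of_lt_pi hφ0 hφπ
  -- Coordinates in which `linStep c` is multiplication by `exp (i φ)` and the left half-plane
  -- becomes the sector of arguments in `[0, π)`. The potential is the argument divided by `π`.
  let w : ℝ × ℝ → ℂ := fun z => ⟨(z.2 - z.1 * Real.cos φ) / Real.sin φ, -z.1⟩
  have hw0 : ∀ z, symbol z = .b → w z ≠ 0 := by
    intro z hz h
    apply ne_zero_of_symbol_eq_b hz
    have h1 : z.1 = 0 := by simpa [w] using congrArg Complex.im h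
    have h2 := congrArg Complex.re h
    simp only [w, h1, zero_mul, sub_zero, Complex.zero_re, div_eq_zero_iff, hsin.ne', or_false] at h2
    exact Prod.ext h1 h2
  have harg : ∀ z, symbol z = .b → 0 ≤ (w z).arg ∧ (w z).arg < Real.pi := by
    intro z hz
    refine ⟨Complex.arg_nonneg_iff.mpr ?_, lt_of_le_of_ne (Complex.arg_le_pi _) ?_⟩
    · rcases symbol_eq_b_iff.mp hz with h | h
      · simp [w, h.le]
      · simp [w, h.1]
    · intro h
      rw [Complex.arg_eq_pi_iff] at h
      rcases symbol_eq_b_iff.mp hz with h' | h'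
      · simp [w, h'.ne] at h
      · have := h.1
        simp only [w, h'.1, zero_mul, sub_zero] at this
        linarith [div_pos h'.2 hsin]
  have hstep : ∀ z, w (linStep c z) = ‖w z‖ *
      (Complex.cos ((w z).arg + φ : ℝ) + Complex.sin ((w z).arg + φ : ℝ) * Complex.I) := by
    intro z
    have h1 := Complex.norm_mul_cos_arg (w z)
    have h2 := Complex.norm_mul_sin_arg (w z)
    have hs := Real.sin_sq_add_cos_sq φ
    apply Complex.ext
    · rw [← Complex.ofReal_cos, ← Complex.ofReal_sin, Complex.re_ofReal_mul]
      simp only [Complex.add_re, Complex.ofReal_re, Complex.mul_re, Complex.I_re, Complex.ofReal_im,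
        Complex.I_im, mul_zero, zero_mul, sub_zero, add_zero]
      rw [Real.cos_add, mul_sub, ← mul_assoc, ← mul_assoc, h1, h2]
      simp only [w, linStep, hcos]
      field_simp
      linear_combination (-z.1) * hs
    · rw [← Complex.ofReal_cos, ← Complex.ofReal_sin, Complex.im_ofReal_mul]
      simp only [Complex.add_im, Complex.ofReal_re, Complex.mul_im, Complex.I_re, Complex.ofReal_im,
        Complex.I_im, mul_zero, mul_one, zero_add, add_zero]
      rw [Real.sin_add, mul_add, ← mul_assoc, ← mul_assoc, h1, h2]
      simp only [w, linStep, hcos]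
      field_simp
      ring
  have hneg : ∀ z, w (-z) = -w z := by
    intro z
    apply Complex.ext <;> simp [w]
    ring
  refine ⟨fun z => if symbol z = .b then (w z).arg / Real.pi else 0, ?_, ?_, ?_⟩
  · intro z
    split_ifs with h
    · obtain ⟨h1, h2⟩ := harg z h
      rw [abs_of_nonneg (by positivity), div_le_one Real.pi_pos]
      exact h2.le
    · simp
  · intro z hz hz'
    simp only [hz, hz', if_true, ← add_div]
    congr 1
    obtain ⟨h1, h2⟩ := harg z hz
    have hr : 0 < ‖w z‖ := norm_pos_iff.mpr (hw0 z hz)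
    -- Beyond `π` the principal argument wraps to a negative value, which is impossible in the left
    -- half-plane.
    rcases le_or_gt ((w z).arg + φ) Real.pi with h | h
    · rw [hstep z, Complex.arg_mul_cos_add_sin_mul_I hr ⟨by linarith, h⟩]
    · exfalso
      have h3 : (w (linStep c z)).arg = (w z).arg + φ - 2 * Real.pi := by
        rw [hstep z, show (w z).arg + φ = ((w z).arg + φ - 2 * Real.pi) + 2 * Real.pi by ring,
          Complex.ofReal_add _ (2 * Real.pi), Complex.ofReal_mul, Complex.ofReal_ofNat,
          Complex.cos_add_two_pi, Complex.sin_add_two_pi,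
          Complex.arg_mul_cos_add_sin_mul_I hr ⟨by linarith, by linarith⟩]
        ring
      linarith [(harg _ hz').1]
  · intro z hz hz'
    have hz'' : symbol (-linStep c z) = .b := by
      rw [symbol_neg, hz', Letter.flip]
      intro h
      have := (entering_of_symbol_linStep hz hz').2
      rw [h] at this
      simp at this
    simp only [hz, hz'', if_true]
    have hπ := Real.pi_pos
    obtain ⟨h1, h2⟩ := harg z hz
    have hr : 0 < ‖w z‖ := norm_pos_iff.mpr (hw0 z hz)
    have h3 : (w (-linStep c z)).arg = (w z).arg + φ - Real.pi := by
      rw [hneg, hstep z, ← Complex.arg_mul_cos_add_sin_mul_I (θ := (w z).arg + φ - Real.pi) hr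
          ⟨by linarith, by linarith⟩, Complex.ofReal_sub _ Real.pi, Complex.cos_sub_pi,
          Complex.sin_sub_pi]
      congr 1
      ring
    rw [h3]
    field_simp

/-- If an event occurs at most once along every orbit of `g`, then it is a coboundary. -/
theorem exists_coboundary_of_invariant {α : Type*} (g : α → α) (p q : α → Prop)
    (hpq : ∀ z, p z → q (g z)) (hq : ∀ z, q z → q (g z)) (hqp : ∀ z, q z → ¬ p z) :
    ∃ β : α → ℝ, (∀ z, |β z| ≤ 1) ∧ (∀ z, p z → β (g z) = β z - 1) ∧
      ∀ z, ¬ p z → β (g z) = β z := by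
  classical
  have hq' : ∀ z, q z → ¬ ∃ m, p (g^[m] z) := by
    rintro z hz ⟨m, hm⟩
    refine hqp _ ?_ hm
    clear hm
    induction m with
    | zero => exact hz
    | succ m ih => rw [Function.iterate_succ_apply']; exact hq _ ih
  -- The value is 1 as long as the event lies ahead, and 0 otherwise.
  refine ⟨fun z => if ∃ m, p (g^[m] z) then 1 else 0, fun z => ?_, fun z hz => ?_, fun z hz => ?_⟩
  · dsimp only; split_ifs <;> simp
  · dsimp only
    rw [if_neg (hq' _ (hpq z hz)), if_pos ⟨0, hz⟩]; simp
  · have : (∃ m, p (g^[m] (g z))) ↔ ∃ m, p (g^[m] z) := by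
      constructor
      · rintro ⟨m, hm⟩
        exact ⟨m + 1, hm⟩
      · rintro ⟨_ | m, hm⟩
        · exact (hz hm).elim
        · exact ⟨m, hm⟩
    simp only [this]

/-- The representative in the left half-plane of the line through `linStep c z`. -/
noncomputable def projStep (c : ℝ) (z : ℝ × ℝ) : ℝ × ℝ :=
  if symbol (linStep c z) = .b then linStep c z else -linStep c z

/-- The cone `x ≤ 0`, `x ≤ y` is invariant, free of crossings, and entered at any crossing, so at
most one crossing occurs. -/
theorem exists_isPotential_of_two_le {c : ℝ} (hc : 2 ≤ c) : ∃ β, IsPotential c 0 β := by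
  refine Exists.elim (exists_coboundary_of_invariant (projStep c)
    (fun z => symbol z = .b ∧ symbol (linStep c z) = .a) (fun z => z.1 ≤ 0 ∧ z.1 ≤ z.2) ?_ ?_ ?_)
    fun β ⟨h1, h2, h3⟩ => ?_
  · rintro z ⟨hz, hz'⟩
    have := entering_of_symbol_linStep hz hz'
    simp only [projStep, hz', reduceCtorEq, if_false]
    simp only [Prod.fst_neg, Prod.snd_neg]
    constructor <;> linarith
  · rintro z ⟨h1, h2⟩
    rw [projStep]
    split_ifs with h
    · simp only [linStep]
      constructor <;> nlinarith
    · have := symbol_eq_a_iff.mp (by by_contra h'; exact h (symbol_ne_a_iff.mp h'))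
      simp only [linStep] at this ⊢
      simp only [Prod.fst_neg, Prod.snd_neg]
      rcases this with h | h <;> constructor <;> nlinarith
  · rintro z ⟨h1, h2⟩ ⟨hz, hz'⟩
    obtain ⟨h3, h4⟩ := entering_of_symbol_linStep hz hz'
    simp only [linStep] at h3 h4
    nlinarith
  · refine ⟨β, h1, fun z hz hz' => ?_, fun z hz hz' => ?_⟩
    · simpa [projStep, hz'] using h3 z (by simp [hz'])
    · simpa [projStep, hz'] using h2 z ⟨hz, hz'⟩

/-- Dual to the case `c ≥ 2`: from the cone `x ≤ 0`, `y ≤ -x` every step in the left half-plane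
crosses, so the exceptional event is a step without crossing. The coboundary is negated because such
a step must raise the potential. -/
theorem exists_isPotential_of_le_neg_two {c : ℝ} (hc : c ≤ -2) : ∃ β, IsPotential c 1 β := by
  refine Exists.elim (exists_coboundary_of_invariant (projStep c)
    (fun z => symbol z = .b ∧ symbol (linStep c z) = .b)
    (fun z => z.1 ≤ 0 ∧ z.2 ≤ -z.1) ?_ ?_ ?_)
    fun β ⟨h1, h2, h3⟩ => ?_
  · rintro z ⟨hz, hz'⟩
    simp only [projStep, hz', if_true]
    rw [symbol_eq_b_iff] at hz hz'
    simp only [linStep] at hz' ⊢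
    have h1 : z.1 ≤ 0 := hz.elim le_of_lt fun h => h.1.le
    have h2 : c * z.1 - z.2 < 0 := hz'.resolve_right fun h => by linarith [h.2]
    exact ⟨h2.le, by linarith⟩
  · rintro z ⟨h1, h2⟩
    rw [projStep]
    split_ifs with h
    · rcases symbol_eq_b_iff.mp h with h | h <;> simp only [linStep] at h
      · nlinarith
      · linarith [h.2]
    · simp only [linStep, Prod.fst_neg, Prod.snd_neg]
      constructor <;> nlinarith
  · rintro z ⟨h1, h2⟩ ⟨hz, hz'⟩
    have h3 : z.1 < 0 := (symbol_eq_b_iff.mp hz).resolve_right fun h => by linarith [h.1, h.2]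
    rcases symbol_eq_b_iff.mp hz' with h | h <;> simp only [linStep] at h
    · nlinarith
    · linarith [h.2]
  · refine ⟨fun z => -β z, by simpa using h1, fun z hz hz' => ?_, fun z hz hz' => ?_⟩
    · have := h2 z ⟨hz, hz'⟩
      simp only [projStep, hz', if_true] at this
      linarith
    · simpa [projStep, hz'] using h3 z (by simp [hz'])

/-- `Real.arccos` is constant outside `[-1, 1]`, with values `π` and `0`, so one formula covers all
three regimes. -/
theorem exists_isPotential (c : ℝ) : ∃ β, IsPotential c (Real.arccos (c / 2) / Real.pi) β := by
  rcases lt_or_ge |c| 2 with h | h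
  · exact exists_isPotential_of_abs_lt_two h
  · rcases le_abs.mp h with h | h
    · rw [Real.arccos_eq_zero.mpr (by linarith), zero_div]
      exact exists_isPotential_of_two_le h
    · rw [Real.arccos_eq_pi.mpr (by linarith), div_self Real.pi_ne_zero]
      exact exists_isPotential_of_le_neg_two (by linarith)

/-! ### Bounded discrepancy -/

/-- The sums of `f` along all orbits outside the origin grow like `n * m`, uniformly up to a
bounded error. -/
def HasBoundedDiscrepancy (a b : ℝ) (f : ℝ × ℝ → ℝ) (m : ℝ) : Prop :=
  ∃ K, ∀ z : ℝ × ℝ, z ≠ 0 → ∀ n : ℕ, |∑ t ∈ Finset.range n, f ((F a b)^[t] z) - n * m| ≤ K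

theorem hasBoundedDiscrepancy_of_coboundary {a b : ℝ} {f : ℝ × ℝ → ℝ} {m : ℝ} (g : ℝ × ℝ → ℝ)
    (K : ℝ) (hg : ∀ z, z ≠ 0 → |g z| ≤ K) (hf : ∀ z, z ≠ 0 → f z - m = g (F a b z) - g z) :
    HasBoundedDiscrepancy a b f m := by
  refine ⟨K + K, fun z hz n => ?_⟩
  have : ∑ t ∈ Finset.range n, f ((F a b)^[t] z) - n * m = g ((F a b)^[n] z) - g z := by
    induction n with
    | zero => simp
    | succ n ih =>
      rw [Finset.sum_range_succ, Function.iterate_succ_apply']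
      push_cast
      linear_combination ih + hf _ (iterate_F_ne_zero hz n)
  rw [this]
  exact (abs_sub _ _).trans (add_le_add (hg _ (iterate_F_ne_zero hz n)) (hg z hz))

theorem HasBoundedDiscrepancy.neg {a b : ℝ} {f f' : ℝ × ℝ → ℝ} {m : ℝ}
    (h : HasBoundedDiscrepancy a b f m) (hf : ∀ z, z ≠ 0 → f' (-z) = f z) :
    HasBoundedDiscrepancy b a f' m := by
  obtain ⟨K, hK⟩ := h
  refine ⟨K, fun z hz n => ?_⟩
  have hz' := neg_ne_zero.mpr hz
  convert hK (-z) hz' n using 4 with t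
  rw [← hf _ (iterate_F_ne_zero hz' t), ← iterate_F_neg hz', neg_neg]

theorem HasBoundedDiscrepancy.one_sub {a b : ℝ} {f f' : ℝ × ℝ → ℝ} {m : ℝ}
    (h : HasBoundedDiscrepancy a b f m) (hf : ∀ z, f' z = 1 - f z) :
    HasBoundedDiscrepancy a b f' (1 - m) := by
  obtain ⟨K, hK⟩ := h
  refine ⟨K, fun z hz n => ?_⟩
  rw [← abs_neg]
  convert hK z hz n using 2
  simp only [hf, Finset.sum_sub_distrib, Finset.sum_const, Finset.card_range, nsmul_eq_mul]
  ring

theorem tendsto_one_div_mul_of_abs_sub_le {u : ℕ → ℝ} {m K : ℝ} (h : ∀ n : ℕ, |u n - n * m| ≤ K) :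
    Tendsto (fun n : ℕ => (1 / (n : ℝ)) * u n) atTop (𝓝 m) := by
  rw [tendsto_iff_norm_sub_tendsto_zero]
  refine squeeze_zero' (.of_forall fun _ => norm_nonneg _) ?_ (tendsto_const_div_atTop_nhds_zero_nat K)
  filter_upwards [eventually_gt_atTop 0] with n hn
  have hn' : (0 : ℝ) < n := by exact_mod_cast hn
  have : 1 / (n : ℝ) * u n - m = (u n - n * m) / n := by field_simp
  rw [this, Real.norm_eq_abs, abs_div, abs_of_pos hn']
  gcongr
  exact h n

/-! ### Counting factors in orbit words -/

/-- The indicator function of the points with symbol `x`. -/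
noncomputable def symbolIndicator (x : Letter) (z : ℝ × ℝ) : ℝ :=
  if symbol z = x then 1 else 0

/-- The indicator function of the points with symbol `x` whose image has symbol `y`. -/
noncomputable def transitionIndicator (a b : ℝ) (x y : Letter) (z : ℝ × ℝ) : ℝ :=
  if symbol z = x ∧ symbol (F a b z) = y then 1 else 0

theorem length_orbitWord (a b : ℝ) (z : ℝ × ℝ) (n : ℕ) : (orbitWord a b z n).length = n := by
  simp [orbitWord]

theorem drop_orbitWord (a b : ℝ) (z : ℝ × ℝ) {n i : ℕ} (hi : i < n) :
    (orbitWord a b z n).drop i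
      = symbol ((F a b)^[i] z) :: (orbitWord a b z n).drop (i + 1) := by
  rw [List.drop_eq_getElem_cons (by rwa [length_orbitWord])]
  simp [orbitWord]

theorem occ_singleton_orbitWord (a b : ℝ) (x : Letter) (z : ℝ × ℝ) (n : ℕ) :
    (occ [x] (orbitWord a b z n) : ℝ)
      = ∑ t ∈ Finset.range n, symbolIndicator x ((F a b)^[t] z) := by
  rw [occ, length_orbitWord, Finset.card_filter, Nat.cast_sum]
  refine Finset.sum_congr rfl fun i hi => ?_
  rw [drop_orbitWord a b z (Finset.mem_range.mp hi), symbolIndicator]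
  simp [List.cons_prefix_cons, eq_comm]

theorem abs_occ_pair_orbitWord_sub_le (a b : ℝ) (x y : Letter) (z : ℝ × ℝ) (n : ℕ) :
    |(occ [x, y] (orbitWord a b z n) : ℝ)
      - ∑ t ∈ Finset.range n, transitionIndicator a b x y ((F a b)^[t] z)| ≤ 1 := by
  rcases n with _ | n
  · simp [occ, orbitWord]
  -- A pair needs two letters, so the last position of the word contributes nothing and the sum
  -- stops one term earlier.
  have h : (occ [x, y] (orbitWord a b z (n + 1)) : ℝ)
      = ∑ t ∈ Finset.range n, transitionIndicator a b x y ((F a b)^[t] z) := by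
    rw [occ, length_orbitWord, Finset.card_filter, Nat.cast_sum, Finset.sum_range_succ,
      drop_orbitWord a b z n.lt_succ_self, List.drop_of_length_le (length_orbitWord ..).le]
    simp only [List.cons_prefix_cons, List.prefix_nil, reduceCtorEq, and_false, if_false,
      Nat.cast_zero, add_zero]
    refine Finset.sum_congr rfl fun i hi => ?_
    have hi := Finset.mem_range.mp hi
    rw [drop_orbitWord a b z (by omega : i < n + 1), drop_orbitWord a b z (by omega : i + 1 < n + 1),
      transitionIndicator, Function.iterate_succ_apply']
    simp [List.cons_prefix_cons, eq_comm]
  rw [h, Finset.sum_range_succ, sub_add_cancel_left, abs_neg, transitionIndicator]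
  split_ifs <;> simp

theorem isRotationNumber_of_hasBoundedDiscrepancy {a b θ : ℝ}
    (h : HasBoundedDiscrepancy a b (transitionIndicator a b .a .b) θ) :
    IsRotationNumber a b θ := by
  obtain ⟨K, hK⟩ := h
  refine fun z hz => tendsto_one_div_mul_of_abs_sub_le (K := 1 + K) fun n => ?_
  exact (abs_sub_le _ _ _).trans (add_le_add (abs_occ_pair_orbitWord_sub_le a b .a .b z n) (hK z hz n))

theorem isDensity_of_hasBoundedDiscrepancy {a b ρ : ℝ}
    (h : HasBoundedDiscrepancy a b (symbolIndicator .a) ρ) : IsDensity a b ρ := by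
  obtain ⟨K, hK⟩ := h
  have h1 := fun n => hK (0, 1) (by simp) n
  have h2 := fun n => hK (0, -1) (by simp) n
  simp only [← occ_singleton_orbitWord] at h1 h2
  have := (tendsto_one_div_mul_of_abs_sub_le h1).add (tendsto_one_div_mul_of_abs_sub_le h2)
  rw [IsDensity]
  convert this.div_const 2 using 2
  · rw [one_div_mul_eq_div, one_div_mul_eq_div, one_div_mul_eq_div, ← add_div, div_div, mul_comm]
  · rw [add_self_div_two]

theorem transitionIndicator_neg (a b : ℝ) {z : ℝ × ℝ} (hz : z ≠ 0) :
    transitionIndicator b a .a .b (-z) = transitionIndicator a b .b .a z := by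
  rw [transitionIndicator, transitionIndicator, F_neg hz, symbol_neg hz, symbol_neg (F_ne_zero hz)]
  cases symbol z <;> cases symbol (F a b z) <;> simp [Letter.flip]

theorem symbolIndicator_neg {z : ℝ × ℝ} (hz : z ≠ 0) :
    symbolIndicator .b (-z) = symbolIndicator .a z := by
  rw [symbolIndicator, symbolIndicator, symbol_neg hz]
  cases symbol z <;> simp [Letter.flip]

theorem symbolIndicator_a_eq (z : ℝ × ℝ) : symbolIndicator .a z = 1 - symbolIndicator .b z := by
  rw [symbolIndicator, symbolIndicator]
  cases symbol z <;> simp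

/-! ### Rotation number and density on the lines `a = zeta κ` and `b = zeta κ` -/

/-- The exit time is a countdown: it drops by one at each letter `a` and is reset from 0 to `κ` at
each crossing. -/
theorem exitTime_zeta_F_sub {κ : ℕ} (hκ : 2 ≤ κ) (c : ℝ) {z : ℝ × ℝ} (hz : z ≠ 0) :
    (exitTime (zeta κ) c (F (zeta κ) c z) : ℝ) - exitTime (zeta κ) c z
      = κ * transitionIndicator (zeta κ) c .b .a z - symbolIndicator .a z := by
  rcases hs : symbol z
  · rw [exitTime_zeta_of_symbol_a hκ c hz hs]
    simp [transitionIndicator, symbolIndicator, hs]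
  · rw [exitTime_of_symbol_b hs]
    rcases hs' : symbol (F (zeta κ) c z)
    · have hF : F (zeta κ) c z = linStep c z := F_of_symbol_b hs
      obtain ⟨h1, h2⟩ := entering_of_symbol_linStep hs (hF ▸ hs')
      simp [transitionIndicator, symbolIndicator, hs, hs']
      rw [hF, exitTime_zeta_of_entering hκ c h1 h2]
    · rw [exitTime_of_symbol_b hs']
      simp [transitionIndicator, symbolIndicator, hs, hs']

/-- The exit point is constant during an excursion, and a crossing moves it to `-linStep c z`,
exactly the reflection in `IsPotential.cross`. -/
theorem IsPotential.exitPoint_zeta_F_sub {κ : ℕ} (hκ : 2 ≤ κ) {c ν : ℝ} {β : ℝ × ℝ → ℝ}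
    (hβ : IsPotential c ν β) {z : ℝ × ℝ} (hz : z ≠ 0) :
    β (exitPoint (zeta κ) c (F (zeta κ) c z)) - β (exitPoint (zeta κ) c z)
      = ν * (1 - symbolIndicator .a z) - transitionIndicator (zeta κ) c .b .a z := by
  rcases hs : symbol z
  · rw [exitPoint_zeta_of_symbol_a hκ c hz hs]
    simp [transitionIndicator, symbolIndicator, hs]
  · have hF : F (zeta κ) c z = linStep c z := F_of_symbol_b hs
    rw [exitPoint_of_symbol_b hs]
    rcases hs' : symbol (F (zeta κ) c z)
    · obtain ⟨h1, h2⟩ := entering_of_symbol_linStep hs (hF ▸ hs')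
      have := hβ.cross z hs (hF ▸ hs')
      simp only [transitionIndicator, symbolIndicator, hs, hs']
      rw [hF, exitPoint_zeta_of_entering hκ c h1 h2, this]
      simp; ring
    · rw [exitPoint_of_symbol_b hs', hF, hβ.stay z hs (hF ▸ hs')]
      simp [transitionIndicator, symbolIndicator, hs, hs']

theorem abs_symbolIndicator_le (x : Letter) (z : ℝ × ℝ) : |symbolIndicator x z| ≤ 1 := by
  rw [symbolIndicator]; split_ifs <;> simp

theorem transitionIndicator_ab_eq (a b : ℝ) (z : ℝ × ℝ) :
    transitionIndicator a b .a .b z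
      = transitionIndicator a b .b .a z + symbolIndicator .a z - symbolIndicator .a (F a b z) := by
  simp only [transitionIndicator, symbolIndicator]
  cases symbol z <;> cases symbol (F a b z) <;> simp

theorem hasBoundedDiscrepancy_zeta {κ : ℕ} (hκ : 2 ≤ κ) (c : ℝ) {θ : ℝ}
    (hθ : θ = Real.arccos (c / 2) / (κ * Real.arccos (c / 2) + Real.pi)) :
    HasBoundedDiscrepancy (zeta κ) c (transitionIndicator (zeta κ) c .b .a) θ ∧
      HasBoundedDiscrepancy (zeta κ) c (transitionIndicator (zeta κ) c .a .b) θ ∧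
      HasBoundedDiscrepancy (zeta κ) c (symbolIndicator .a) (κ * θ) := by
  obtain ⟨β, hβ⟩ := exists_isPotential c
  set ν := Real.arccos (c / 2) / Real.pi with hν
  have hπ := Real.pi_pos
  have hν0 : 0 ≤ ν := div_nonneg (Real.arccos_nonneg _) hπ.le
  have hpos : 0 < 1 + κ * ν := by positivity
  have hθν : θ * (1 + κ * ν) = ν := by
    have : 0 < κ * Real.arccos (c / 2) + Real.pi := by
      have := Real.arccos_nonneg (c / 2)
      positivity
    rw [hθ, hν, div_mul_eq_mul_div, div_eq_iff this.ne']
    field_simp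
    ring
  -- This combination eliminates the indicator of `a` from the two coboundary identities, leaving
  -- `(1 + κ ν) T - ν`, where `T` is the crossing indicator.
  set g : ℝ × ℝ → ℝ := fun z =>
    (ν * exitTime (zeta κ) c z - β (exitPoint (zeta κ) c z)) / (1 + κ * ν) with hg
  have hτ : ∀ z, z ≠ 0 → |(exitTime (zeta κ) c z : ℝ)| ≤ κ := fun z hz => by
    rw [Nat.abs_cast]; exact_mod_cast exitTime_zeta_le hκ c hz
  have hgK : ∀ z, z ≠ 0 → |g z| ≤ (ν * κ + 1) / (1 + κ * ν) := fun z hz => by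
    rw [hg, abs_div, abs_of_pos hpos]
    gcongr
    refine (abs_sub _ _).trans (add_le_add ?_ (hβ.abs_le _))
    rw [abs_mul, abs_of_nonneg hν0]
    gcongr
    exact hτ z hz
  have hgF : ∀ z, z ≠ 0 → transitionIndicator (zeta κ) c .b .a z - θ = g (F (zeta κ) c z) - g z := by
    intro z hz
    rw [hg, ← sub_div, eq_div_iff hpos.ne']
    linear_combination -hθν - ν * exitTime_zeta_F_sub hκ c hz + hβ.exitPoint_zeta_F_sub hκ hz
  refine ⟨hasBoundedDiscrepancy_of_coboundary g _ hgK hgF, ?_, ?_⟩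
  · refine hasBoundedDiscrepancy_of_coboundary (fun z => g z - symbolIndicator .a z)
      ((ν * κ + 1) / (1 + κ * ν) + 1) (fun z hz => ?_) fun z hz => ?_
    · exact (abs_sub _ _).trans (add_le_add (hgK z hz) (abs_symbolIndicator_le _ _))
    · rw [transitionIndicator_ab_eq]
      linear_combination hgF z hz
  · refine hasBoundedDiscrepancy_of_coboundary (fun z => κ * g z - exitTime (zeta κ) c z)
      (κ * ((ν * κ + 1) / (1 + κ * ν)) + κ) (fun z hz => ?_) fun z hz => ?_
    · refine (abs_sub _ _).trans (add_le_add ?_ (hτ z hz))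
      rw [abs_mul, Nat.abs_cast]
      exact mul_le_mul_of_nonneg_left (hgK z hz) (Nat.cast_nonneg κ)
    · linear_combination κ * hgF z hz + exitTime_zeta_F_sub hκ c hz

end PLMap

theorem mainTheorem10 (κ : ℕ) (hκ : 2 ≤ κ) :
    PLMap.IsCriticalCurve (List.replicate κ PLMap.Letter.a) 1
        {p : ℝ × ℝ | ∃ b : ℝ, p = (PLMap.zeta κ, b)} ∧
    PLMap.IsCriticalCurve (List.replicate κ PLMap.Letter.b) 1
        {p : ℝ × ℝ | ∃ a : ℝ, p = (a, PLMap.zeta κ)} ∧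
    ∀ c : ℝ, ∃ θ ρ : ℝ,
      (PLMap.IsRotationNumber (PLMap.zeta κ) c θ ∧
        PLMap.IsDensity (PLMap.zeta κ) c ρ ∧
        ρ = κ * θ ∧
        (2 < c → θ = 0) ∧
        (|c| ≤ 2 → θ = Real.arccos (c / 2) / (κ * Real.arccos (c / 2) + Real.pi)) ∧
        (c < -2 → θ = 1 / ((κ : ℝ) + 1))) ∧
      (PLMap.IsRotationNumber c (PLMap.zeta κ) θ ∧
        PLMap.IsDensity c (PLMap.zeta κ) (1 - ρ)) := by
  refine ⟨PLMap.isCriticalCurve_replicate_a hκ, PLMap.isCriticalCurve_replicate_b hκ, fun c => ?_⟩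
  set θ := Real.arccos (c / 2) / (κ * Real.arccos (c / 2) + Real.pi) with hθ
  obtain ⟨hba, hab, ha⟩ := PLMap.hasBoundedDiscrepancy_zeta hκ c hθ
  refine ⟨θ, κ * θ, ⟨PLMap.isRotationNumber_of_hasBoundedDiscrepancy hab,
    PLMap.isDensity_of_hasBoundedDiscrepancy ha, rfl, fun hc => ?_, fun _ => rfl, fun hc => ?_⟩,
    -- The reflection turns `ba` into `ab`, so the frequency of `ba` is what is needed here.
    PLMap.isRotationNumber_of_hasBoundedDiscrepancy
      (hba.neg fun z hz => PLMap.transitionIndicator_neg _ _ hz),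
    PLMap.isDensity_of_hasBoundedDiscrepancy
      ((ha.neg fun z hz => PLMap.symbolIndicator_neg hz).one_sub PLMap.symbolIndicator_a_eq)⟩
  · rw [hθ, Real.arccos_eq_zero.mpr (by linarith), zero_div]
  · have hπ := Real.pi_pos
    rw [hθ, Real.arccos_eq_pi.mpr (by linarith)]
    field_simp
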